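/- Let $n\ge 10$ be an integer and let $\Delta_{3,n}$ be the set of $x\in\mathbb{R}_{\ge 0}^3$ with $x_1+x_2+x_3=1$ and $nx_i\in\mathbb{Z}$ for all $i$. Let $E_{3,n}=\{xy : x,y\in\Delta_{3,n},\ \|x-y\|_1=2/n\}$, $\operatorname{Support}(x)=\{i : x_i\neq 0\}$, and let $L_{ij}$ be the set of edges $xy\in E_{3,n}$ with $\operatorname{Support}(x),\operatorname{Support}(y)\subseteq\{i,j\}$. The terminals are the unit vectors $e^1,e^2,e^3$. The edge costs $w$ of the instance $J$ (the gap instance of Angelidakis, Makarychev and Manurangsi, scaled by $6/5$) are as follows. Put $\rho=\frac{3}{5n}$, $H=\{x\in\Delta_{3,n} : x_i\le 2/3\ \text{for all } i\}$ and $T_i=\{x\in\Delta_{3,n} : x_i>2/3\}$. Every edge with both end nodes in $H$ has cost $\rho$. Among the edges with an end node outside $H$: on each side $L_{ij}$, the edges counted from the terminal nearest to them have cost $\frac n3\rho,\ (\frac n3-1)\rho,\ (\frac n3-2)\rho,\dots$; an edge on none of the sides has cost $0$ if for some $i$ both its end nodes lie in $T_i$ and it is parallel to the side opposite to $e^i$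 (that is, its end nodes have the same $i$-th coordinate), and cost $\rho$ otherwise. Let $Q:\Delta_{3,n}\to\{1,2,3,4\}$ be a non-opposite cut, that is, $Q(e^i)=i$ for $i\in\{1,2,3\}$ and $Q(x)\in\operatorname{Support}(x)\cup\{4\}$ for every $x$. Let $\delta(Q)=\{xy\in E_{3,n} : Q(x)\ne Q(y)\}$, and suppose that $Q$ is non-fragmenting, that is, $|\delta(Q)\cap L_{ij}|\le 1$ for some distinct $i,j\in\{1,2,3\}$. If exactly $\alpha n^2$ nodes are labeled $4$ by $Q$, then the cost of $Q$ on $J$ satisfies $$\sum_{e\in\delta(Q)}w(e)\ \ge\ 1.2+0.4\,\alpha-\frac1n .$$ -/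

import Mathlib

namespace AMM

/-- The discretized simplex `Δ_{3,n} = Δ₃ ∩ ((1/n)ℤ)³`. A point `x` is represented by its scaled
coordinate vector `n • x`, that is by a triple of natural numbers with sum `n`. Indices and
terminals are numbered `0, 1, 2`. -/
abbrev Node (n : ℕ) : Type := {v : Fin 3 → ℕ // ∑ i, v i = n}

instance (n : ℕ) : Fintype (Node n) :=
  Fintype.subtype (Finset.Nat.antidiagonalTuple 3 n)
    (fun _ => Finset.Nat.mem_antidiagonalTuple)

/-- The terminal `sᵢ`, the `i`-th unit vector. -/
def terminal (n : ℕ) (i : Fin 3) : Node n :=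
  ⟨Pi.single i n, by simp⟩

/-- The set of indices of the nonzero coordinates. -/
def support {n : ℕ} (x : Node n) : Finset (Fin 3) :=
  Finset.univ.filter fun i => x.1 i ≠ 0

/-- The graph on `Δ_{3,n}` with an edge `xy` whenever `‖x - y‖₁ = 2/n`
(in scaled coordinates: the `ℓ₁`-distance is `2`). -/
def grid (n : ℕ) : SimpleGraph (Node n) where
  Adj x y := ∑ i, |(x.1 i : ℤ) - (y.1 i : ℤ)| = 2
  symm := ⟨fun x y h => by simpa only [abs_sub_comm] using h⟩
  loopless := ⟨fun x h => by simp at h⟩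

instance (n : ℕ) : DecidableRel (grid n).Adj :=
  fun x y => inferInstanceAs (Decidable (∑ i, |(x.1 i : ℤ) - (y.1 i : ℤ)| = 2))

/-- The boundary edges `L_{ij}` between the terminals `sᵢ` and `sⱼ`. -/
def sideEdges (n : ℕ) (i j : Fin 3) : Finset (Sym2 (Node n)) :=
  (grid n).edgeFinset.filter fun e => ∀ x ∈ e, support x ⊆ {i, j}

/-- A cut is a labeling with four labels that gives each terminal its own label.
The labels `1, 2, 3` are `Fin.castSucc i` for `i : Fin 3`, the label `4` is `Fin.last 3`. -/
def IsCut {n : ℕ} (Q : Node n → Fin 4) : Prop :=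
  ∀ i : Fin 3, Q (terminal n i) = i.castSucc

/-- A non-opposite cut: `Q x ∈ Support x ∪ {4}` for every node `x`. -/
def IsNonOpposite {n : ℕ} (Q : Node n → Fin 4) : Prop :=
  IsCut Q ∧ ∀ x, (∃ i ∈ support x, Q x = i.castSucc) ∨ Q x = Fin.last 3

/-- The cut-set `δ(Q)`: the edges whose two end nodes have different labels. -/
def cutSet {n : ℕ} (Q : Node n → Fin 4) : Finset (Sym2 (Node n)) :=
  (grid n).edgeFinset.filter fun e => ¬ (e.map Q).IsDiag

/-- A fragmenting cut: each side of the triangle contains at least two edges of the cut-set. -/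
def IsFragmenting {n : ℕ} (Q : Node n → Fin 4) : Prop :=
  ∀ i j : Fin 3, i ≠ j → 2 ≤ (cutSet Q ∩ sideEdges n i j).card

/-- The middle hexagon `H`, where all coordinates are at most `2/3`. -/
def InHexagon {n : ℕ} (x : Node n) : Prop := ∀ i, 3 * x.1 i ≤ 2 * n

instance {n : ℕ} (x : Node n) : Decidable (InHexagon x) :=
  inferInstanceAs (Decidable (∀ i, 3 * x.1 i ≤ 2 * n))

/-- The corner triangle `Tᵢ`, where the `i`-th coordinate is larger than `2/3`. -/
def InCorner {n : ℕ} (i : Fin 3) (x : Node n) : Prop := 2 * n < 3 * x.1 i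

instance {n : ℕ} (i : Fin 3) (x : Node n) : Decidable (InCorner i x) :=
  inferInstanceAs (Decidable (2 * n < 3 * x.1 i))

/-- The number of edges of a side of the triangle that lie strictly between the side's edge `xy`
and the terminal nearest to it, so `0` for the edge closest to the terminal, `1` for the second
closest, and so on: `n` minus the largest scaled coordinate of `x` and `y`. -/
def rankFromCorner {n : ℕ} (x y : Node n) : ℕ :=
  n - Finset.univ.sup fun i => max (x.1 i) (y.1 i)

/-- The cost of the edge `xy` in the scaled instance `J`, in units of `ρ = 3/(5n)`: edges inside
the hexagon cost `1`; outside the hexagon, the edges on the sides of the triangle cost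
`n/3, n/3 - 1, n/3 - 2, …`, counted from the nearest terminal; the remaining edges cost `0` if they
lie in a corner triangle `Tᵢ` and are parallel to the side opposite to `sᵢ`, and `1` otherwise. -/
noncomputable def relCost {n : ℕ} (x y : Node n) : ℝ :=
  if InHexagon x ∧ InHexagon y then 1
  else if ∃ i j, i ≠ j ∧ s(x, y) ∈ sideEdges n i j then (n : ℝ) / 3 - rankFromCorner x y
  else if ∃ i, (InCorner i x ∧ InCorner i y) ∧ x.1 i = y.1 i then 0
  else 1

theorem relCost_comm {n : ℕ} (x y : Node n) : relCost x y = relCost y x :=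
  if_congr and_comm rfl <| if_congr (by rw [Sym2.eq_swap])
    (by simp only [rankFromCorner, max_comm]) <|
    if_congr (exists_congr fun _ => and_congr and_comm eq_comm) rfl rfl

/-- The edge costs `w` of the instance `J`. -/
noncomputable def edgeCost (n : ℕ) (e : Sym2 (Node n)) : ℝ :=
  3 / (5 * n) * Sym2.lift ⟨relCost, relCost_comm⟩ e

/-- `Cost_J(F) = ∑_{e ∈ F} w(e)`. -/
noncomputable def costJ {n : ℕ} (F : Finset (Sym2 (Node n))) : ℝ :=
  ∑ e ∈ F, edgeCost n e

end AMM

namespace AMM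

/-! The bound is a calibration, that is, weak linear programming duality. Number labels from `0`, so
that label 4 is `3`, and put `k = ⌊2n/3⌋`. Permute the terminals so that a side with at most one cut
edge joins terminals `0` and `1`; label `3` cannot occur on it (`label_ne_last_of_card_le`).

Each label `l` gets a flow `f_l` on the grid. Summing `f_{Q(x)} - f_{Q(y)}` over the oriented edges
`xy` and regrouping by nodes gives the sum over `x` of the divergence of `f_{Q(x)}` at `x`
(`sum_flow_eq_sum_divergence`). At each node, every label that may occur there has divergence at
least a common `supply`, and label `3` has `2/(3n)` more; a flow can sink only where its label is
forbidden. Hence the sum is at least `3k + 1` (`sum_supply`) plus `2/(3n)` per node labeled `3`,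
whatever the cut.

Conversely, the cut cost in units of `ρ` dominates this sum up to a total error `2/3`. Inside the
hexagon the flows may exceed the cost of a single edge, but not that of a triangle, where labels
that are not all equal cut at least two edges (`down_slack_nonneg`). Side edges are bounded one by
one, and only two of them can fall short, each by at most `1/3`. As `3k ≥ 2n - 2`, this yields
`le_sum_cutWeight`; multiplication by `ρ` gives the theorem. -/

/-! ### Sums over the discrete triangle. -/

/-- The triples of natural numbers with sum `n`. -/
def tri (n : ℕ) : Finset (ℕ × ℕ × ℕ) :=
  (Finset.range (n + 1) ×ˢ Finset.range (n + 1) ×ˢ Finset.range (n + 1)).filter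
    fun u => u.1 + u.2.1 + u.2.2 = n

theorem mem_tri {n : ℕ} {u : ℕ × ℕ × ℕ} : u ∈ tri n ↔ u.1 + u.2.1 + u.2.2 = n := by
  simp only [tri, Finset.mem_filter, Finset.mem_product, Finset.mem_range]
  omega

/-- This shift and its two analogues serve twice: to regroup edge sums by nodes, and to move the
non-side edges from the upward triangles into the downward ones. -/
theorem sum_tri_fst (m : ℕ) (f : ℕ → ℕ → ℕ → ℝ) :
    ∑ u ∈ tri (m + 1), f u.1 u.2.1 u.2.2 =
      ∑ u ∈ (tri (m + 1)).filter (fun u => u.1 = 0), f u.1 u.2.1 u.2.2 +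
        ∑ v ∈ tri m, f (v.1 + 1) v.2.1 v.2.2 := by
  rw [← Finset.sum_filter_add_sum_filter_not (tri (m + 1)) (fun u => u.1 = 0)]
  congr 1
  symm
  refine Finset.sum_nbij' (fun v => (v.1 + 1, v.2.1, v.2.2)) (fun u => (u.1 - 1, u.2.1, u.2.2))
    ?_ ?_ ?_ ?_ ?_ <;> rintro ⟨a, b, c⟩ h <;> simp only [Finset.mem_filter, mem_tri] at h ⊢
  · omega
  · omega
  · simp
  · simp only [Prod.mk.injEq, and_true]; omega

theorem sum_tri_snd (m : ℕ) (f : ℕ → ℕ → ℕ → ℝ) :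
    ∑ u ∈ tri (m + 1), f u.1 u.2.1 u.2.2 =
      ∑ u ∈ (tri (m + 1)).filter (fun u => u.2.1 = 0), f u.1 u.2.1 u.2.2 +
        ∑ v ∈ tri m, f v.1 (v.2.1 + 1) v.2.2 := by
  rw [← Finset.sum_filter_add_sum_filter_not (tri (m + 1)) (fun u => u.2.1 = 0)]
  congr 1
  symm
  refine Finset.sum_nbij' (fun v => (v.1, v.2.1 + 1, v.2.2)) (fun u => (u.1, u.2.1 - 1, u.2.2))
    ?_ ?_ ?_ ?_ ?_ <;> rintro ⟨a, b, c⟩ h <;> simp only [Finset.mem_filter, mem_tri] at h ⊢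
  · omega
  · omega
  · simp
  · simp only [Prod.mk.injEq, and_true, true_and]; omega

theorem sum_tri_trd (m : ℕ) (f : ℕ → ℕ → ℕ → ℝ) :
    ∑ u ∈ tri (m + 1), f u.1 u.2.1 u.2.2 =
      ∑ u ∈ (tri (m + 1)).filter (fun u => u.2.2 = 0), f u.1 u.2.1 u.2.2 +
        ∑ v ∈ tri m, f v.1 v.2.1 (v.2.2 + 1) := by
  rw [← Finset.sum_filter_add_sum_filter_not (tri (m + 1)) (fun u => u.2.2 = 0)]
  congr 1
  symm
  refine Finset.sum_nbij' (fun v => (v.1, v.2.1, v.2.2 + 1)) (fun u => (u.1, u.2.1, u.2.2 - 1))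
    ?_ ?_ ?_ ?_ ?_ <;> rintro ⟨a, b, c⟩ h <;> simp only [Finset.mem_filter, mem_tri] at h ⊢
  · omega
  · omega
  · simp
  · simp only [Prod.mk.injEq, true_and]; omega

/-! ### Edge weights, calibrating flows, divergence and slack. -/

/-- The cost, in units of `ρ`, of the edge between `w + eᵢ` and `w + eⱼ`, where `a`, `b`, `c` are
the coordinates of `w` at `i`, `j` and at the third index. -/
noncomputable def weight (n a b c : ℕ) : ℝ :=
  if c = 0 then
    if 2 * n / 3 ≤ a then (a : ℝ) + 1 - 2 * n / 3
    else if 2 * n / 3 ≤ b then (b : ℝ) + 1 - 2 * n / 3 else 1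
  else if 2 * n / 3 < c then 0 else 1

/-- The value on a side of the triangle of the calibrating flow. -/
noncomputable def sideFlow (n a b : ℕ) : ℝ :=
  if 2 * n / 3 ≤ a then (a : ℝ) + 1 - 2 * n / 3
  else if 2 * n / 3 ≤ b then (b : ℝ) + 1 - 2 * n / 3
  else ((2 * n / 3 : ℕ) : ℝ) + 1 - 2 * n / 3

/-- The flow from `w + e₀` to `w + e₂` that drains the nodes with the last label. -/
noncomputable def drain02 (n a b c : ℕ) : ℝ :=
  if 2 * n / 3 < b then 0
  else if b = 0 ∧ 2 * n / 3 < c then (c : ℝ) + 1 - 2 * n / 3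
  else if b + 2 * n / 3 < n ∨ c ≤ a + 1 then 2 / (3 * n) * (c : ℝ)
  else 2 / (3 * n) * ((a : ℝ) + 1)

/-- The flow from `w + e₁` to `w + e₂` that drains the nodes with the last label. -/
noncomputable def drain12 (n a b c : ℕ) : ℝ :=
  if a = 0 ∧ 2 * n / 3 < c then (c : ℝ) + 1 - 2 * n / 3
  else if n ≤ a + 2 * n / 3 then 0
  else if 2 * n / 3 ≤ b then 2 / (3 * n) * ((n : ℝ) - b - 1)
  else if n ≤ b + 1 + 2 * n / 3 then
    2 / (3 * n) * ((n : ℝ) + ((2 * n / 3 : ℕ) : ℝ) - 2 * b - 1)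
  else 2 / (3 * n) * (3 * ((2 * n / 3 : ℕ) : ℝ) + 1 - n)

/-- The calibrating flow of each label along the edge from `w + e₀` to `w + e₁`. -/
noncomputable def flow01 (n a b c : ℕ) : Fin 4 → ℝ :=
  ![if c = 0 then if 2 * n / 3 ≤ b then 0 else sideFlow n a b
    else if 2 * n / 3 < c then 0 else if 2 * n / 3 ≤ a then 1
    else if 2 * n / 3 ≤ b then 0 else 2 / 3,
    if c = 0 then if 2 * n / 3 ≤ b then -sideFlow n b a else 0
    else if 2 * n / 3 < c then 0 else if 2 * n / 3 ≤ a then 0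
    else if 2 * n / 3 ≤ b then -1 else -(2 / 3),
    0, 0]

/-- The calibrating flow of each label along the edge from `w + e₀` to `w + e₂`. -/
noncomputable def flow02 (n a b c : ℕ) : Fin 4 → ℝ :=
  ![if b = 0 then sideFlow n a c
    else if 2 * n / 3 < b then 0 else if 2 * n / 3 ≤ a then 1
    else if 2 * n / 3 ≤ c then 1 else 4 / 3,
    if 2 * n / 3 < b then 0 else if 2 * n / 3 ≤ a then 0
    else if 2 * n / 3 ≤ c then 1 else 2 / 3,
    0, drain02 n a b c]

/-- The calibrating flow of each label along the edge from `w + e₁` to `w + e₂`. -/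
noncomputable def flow12 (n a b c : ℕ) : Fin 4 → ℝ :=
  ![if 2 * n / 3 < a then 0 else if 2 * n / 3 ≤ b then 0
    else if 2 * n / 3 ≤ c then 1 else 2 / 3,
    if a = 0 then sideFlow n b c
    else if 2 * n / 3 < a then 0 else if 2 * n / 3 ≤ b then 1
    else if 2 * n / 3 ≤ c then 1 else 4 / 3,
    0, drain12 n a b c]

/-- The divergence at a node of the calibrating flow of each label. -/
noncomputable def divergence (n a b c : ℕ) (l : Fin 4) : ℝ :=
  (if a = 0 then 0 else flow01 n (a - 1) b c l + flow02 n (a - 1) b c l) +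
  (if b = 0 then 0 else flow12 n a (b - 1) c l - flow01 n a (b - 1) c l) +
  (if c = 0 then 0 else -flow02 n a b (c - 1) l - flow12 n a b (c - 1) l)

/-- The common lower bound on the divergence of the calibrating flows of the labels. -/
noncomputable def supply (n a b c : ℕ) : ℝ :=
  if c ≠ 0 then 0 else if a = 0 ∨ b = 0 then 2 * n / 3
  else if 2 * n / 3 < a ∨ 2 * n / 3 < b then 0
  else if b = 2 * n / 3 then 1 + (2 * n / 3 - ((2 * n / 3 : ℕ) : ℝ)) else 2

/-- The cost of an edge between nodes with the labels `k` and `l` minus the calibrating bound. -/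
noncomputable def slack (x : ℝ) (f : Fin 4 → ℝ) (k l : Fin 4) : ℝ :=
  (if k = l then 0 else x) - (f k - f l)

/-! ### Lower bounds for the divergence. -/

theorem floor_bounds (n : ℕ) : 2 * (n : ℝ) / 3 - 2 / 3 ≤ ((2 * n / 3 : ℕ) : ℝ) ∧
    ((2 * n / 3 : ℕ) : ℝ) ≤ 2 * n / 3 := by
  have h1 : 3 * (2 * n / 3) ≤ 2 * n := by omega
  have h2 : 2 * n ≤ 3 * (2 * n / 3) + 2 := by omega
  have h1' : (3 : ℝ) * ((2 * n / 3 : ℕ) : ℝ) ≤ 2 * n := by exact_mod_cast h1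
  have h2' : (2 : ℝ) * n ≤ 3 * ((2 * n / 3 : ℕ) : ℝ) + 2 := by exact_mod_cast h2
  constructor <;> linarith

/-- Label `0` occurs only where `0 < a`, so its flow is free to sink on the side `a = 0`. Splitting
by the position of each coordinate relative to `k` decides every branch of the flows. -/
theorem supply_le_divergence_zero {n a b c : ℕ} (hn : 10 ≤ n) (h : a + b + c = n) (ha : 0 < a) :
    supply n a b c ≤ divergence n a b c 0 := by
  have hr : (a : ℝ) + b + c = n := by exact_mod_cast h
  have hf := floor_bounds n
  simp only [divergence, supply, flow01, flow02, flow12, sideFlow, Matrix.cons_val_zero]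
  generalize hk : 2 * n / 3 = k at *
  rcases Nat.eq_zero_or_pos b with hb | hb <;> rcases Nat.eq_zero_or_pos c with hc | hc <;>
  rcases lt_trichotomy a k with ha' | ha' | ha' <;>
  rcases lt_trichotomy b k with hb' | hb' | hb' <;>
  rcases lt_trichotomy c k with hc' | hc' | hc' <;>
  first
  | omega
  | (simp (disch := omega) only [if_pos, if_neg, Nat.cast_pred]
     try simp only [hb, hc, ha', hb', hc', Nat.cast_zero] at *
     linarith)

theorem supply_le_divergence_one {n a b c : ℕ} (hn : 10 ≤ n) (h : a + b + c = n) (hb : 0 < b) :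
    supply n a b c ≤ divergence n a b c 1 := by
  have hr : (a : ℝ) + b + c = n := by exact_mod_cast h
  have hf := floor_bounds n
  simp only [divergence, supply, flow01, flow02, flow12, sideFlow, Matrix.cons_val_one,
    Matrix.cons_val_zero]
  generalize hk : 2 * n / 3 = k at *
  rcases Nat.eq_zero_or_pos a with ha | ha <;> rcases Nat.eq_zero_or_pos c with hc | hc <;>
  rcases lt_trichotomy a k with ha' | ha' | ha' <;>
  rcases lt_trichotomy b k with hb' | hb' | hb' <;>
  rcases lt_trichotomy c k with hc' | hc' | hc' <;>
  first
  | omega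
  | (simp (disch := omega) only [if_pos, if_neg, Nat.cast_pred]
     try simp only [ha, hc, ha', hb', hc', Nat.cast_zero] at *
     linarith)

theorem supply_le_divergence_two {n a b c : ℕ} (hc : 0 < c) :
    supply n a b c ≤ divergence n a b c 2 := by
  simp [divergence, supply, flow01, flow02, flow12, hc.ne']

/-- The drain collects `2/(3n)` at each node and carries it to terminal `2`, its sink, which `c < n`
excludes. The side `c = 0` is exempt because label `3` does not occur there. -/
theorem supply_add_le_divergence_three {n a b c : ℕ} (hn : 10 ≤ n) (h : a + b + c = n)
    (hc : 0 < c) (hc' : c < n) :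
    supply n a b c + 2 / (3 * n) ≤ divergence n a b c 3 := by
  have hr : (a : ℝ) + b + c = n := by exact_mod_cast h
  have hn' : (10 : ℝ) ≤ n := by exact_mod_cast hn
  have hf := floor_bounds n
  have hκ : 2 / (3 * (n : ℝ)) * n = 2 / 3 := by field_simp
  have hκ0 : 0 < 2 / (3 * (n : ℝ)) := by positivity
  simp only [divergence, supply, flow01, flow02, flow12, Matrix.cons_val]
  rw [if_pos hc.ne']
  simp only [drain02, drain12]
  generalize hk : 2 * n / 3 = k at *
  -- With `κ` opaque, products such as `κ * a` act as atoms and the cases become linear.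
  generalize 2 / (3 * (n : ℝ)) = κ at *
  have h1 : κ ≤ 2 / 30 := by nlinarith
  have h2 : κ * k ≤ 4 / 9 := by nlinarith
  have h3 : κ * a + κ * b + κ * c = 2 / 3 := by rw [← hκ, ← hr]; ring
  have ha0 : 0 ≤ κ * a := by positivity
  have hb0 : 0 ≤ κ * b := by positivity
  have hc0 : 0 ≤ κ * c := by positivity
  rcases lt_or_ge k c with hkc | hkc
  · have hkc' : (k : ℝ) + 1 ≤ c := by exact_mod_cast hkc
    rcases eq_or_lt_of_le (Nat.succ_le_of_lt hkc) with hkc1 | hkc1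
    · have hkc2 : (c : ℝ) = k + 1 := by rw [← hkc1]; push_cast; ring
      rcases Nat.eq_zero_or_pos a with ha | ha <;> rcases Nat.eq_zero_or_pos b with hb | hb
      · omega
      all_goals
        rcases eq_or_ne (b + 1 + k) n with hbn | hbn
        all_goals
          first
          | omega
          | (simp (disch := omega) only [if_pos, if_neg, Nat.cast_pred]
             try rw [show (b : ℝ) = n - k - 1 by rw [← hbn]; push_cast; ring]
             simp only [hkc2] at *
             linarith)
    · rcases Nat.eq_zero_or_pos a with ha | ha <;> rcases Nat.eq_zero_or_pos b with hb | hb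
      · omega
      all_goals
        rcases eq_or_ne (b + 1 + k) n with hbn | hbn
        all_goals
          first
          | omega
          | (simp (disch := omega) only [if_pos, if_neg, Nat.cast_pred]
             linarith)
  rcases le_or_gt n (a + k) with hak | hak
  · rcases Nat.eq_zero_or_pos b with hb | hb <;>
    · simp (disch := omega) only [if_pos, if_neg, Nat.cast_pred]
      linarith
  rcases lt_or_ge k b with hkb | hkb
  · rcases Nat.eq_zero_or_pos a with ha | ha <;>
    · simp (disch := omega) only [if_pos, if_neg, Nat.cast_pred]
      linarith
  rcases lt_or_ge (b + k) n with hbn | hbn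
  · rcases eq_or_ne (b + 1 + k) n with hbn' | hbn'
    · simp (disch := omega) only [if_pos, if_neg, Nat.cast_pred]
      rw [show (n : ℝ) = b + 1 + k by rw [← hbn']; push_cast; ring]
      linarith
    · simp (disch := omega) only [if_pos, if_neg, Nat.cast_pred]
      linarith
  rcases eq_or_lt_of_le hkb with hkb | hkb <;>
  rcases Nat.eq_zero_or_pos a with ha | ha <;>
  rcases lt_trichotomy c (a + 1) with hca | hca | hca <;>
  rcases eq_or_ne c (a + 2) with hca' | hca'
  all_goals
    first
    | omega
    | (simp (disch := omega) only [if_pos, if_neg, Nat.cast_pred]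
       try rw [hca'] at *
       try rw [hca] at *
       try rw [hkb] at *
       try rw [ha] at *
       try push_cast at *
       linarith)

/-! ### Comparison of the flows with the edge weights. -/

theorem drain_bounds {n a b c : ℕ} (hn : 10 ≤ n) (h : a + b + c + 1 = n) :
    (a ≠ 0 → 0 ≤ drain12 n a b c ∧ drain12 n a b c ≤ 1) ∧
    (b ≠ 0 → 0 ≤ drain02 n a b c ∧ drain02 n a b c ≤ 1) := by
  have hn' : (10 : ℝ) ≤ n := by exact_mod_cast hn
  have hf := floor_bounds n
  have hκ : 2 / (3 * (n : ℝ)) * n = 2 / 3 := by field_simp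
  have hκ0 : 0 < 2 / (3 * (n : ℝ)) := by positivity
  have hr : (a : ℝ) + b + c + 1 = n := by exact_mod_cast h
  simp only [drain02, drain12]
  have ha : (0 : ℝ) ≤ a := a.cast_nonneg
  have hb : (0 : ℝ) ≤ b := b.cast_nonneg
  have hc : (0 : ℝ) ≤ c := c.cast_nonneg
  have key : ∀ x : ℝ, 0 ≤ x → x ≤ 3 / 2 * n →
      0 ≤ 2 / (3 * (n : ℝ)) * x ∧ 2 / (3 * (n : ℝ)) * x ≤ 1 := by
    intro x h0 h1
    exact ⟨by positivity, (mul_le_mul_of_nonneg_left h1 hκ0.le).trans (by linarith)⟩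
  generalize hk : 2 * n / 3 = k at *
  constructor
  · intro ha0
    rw [if_neg (by omega)]
    split_ifs with h2 h3 h4
    · simp
    · apply key <;> linarith
    · have : (b : ℝ) + 1 ≤ k := by exact_mod_cast (by omega : b + 1 ≤ k)
      have : (n : ℝ) ≤ b + 1 + k := by exact_mod_cast h4
      apply key <;> linarith
    · apply key <;> linarith
  · intro hb0
    rw [if_neg (by omega : ¬ (b = 0 ∧ k < c))]
    split_ifs with h2 h3
    · simp
    · apply key <;> linarith
    · apply key <;> linarith

theorem slack_nonneg {x : ℝ} {f : Fin 4 → ℝ} (h : ∀ k l, f k - f l ≤ x) (k l : Fin 4) :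
    0 ≤ slack x f k l := by
  rw [slack]
  split_ifs with hkl
  · simp [hkl]
  · linarith [h k l]

/-- Every edge off the sides lies in exactly one downward triangle, whose corners are the sums of a
base point with two distinct unit vectors. Near the terminals each edge has nonnegative slack; in
the middle only the sum over the triangle does. -/
theorem down_slack_nonneg {n a b c : ℕ} (hn : 10 ≤ n) (h : a + b + c + 2 = n) (x y z : Fin 4) :
    0 ≤ slack (weight n a b (c + 1)) (flow01 n a b (c + 1)) y x +
      slack (weight n a c (b + 1)) (flow02 n a (b + 1) c) z x +
      slack (weight n b c (a + 1)) (flow12 n (a + 1) b c) z y := by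
  obtain ⟨hp0, hp1⟩ := (drain_bounds (n := n) (a := a) (b := b + 1) (c := c) hn (by omega)).2
    (by omega)
  obtain ⟨hq0, hq1⟩ := (drain_bounds (n := n) (a := a + 1) (b := b) (c := c) hn (by omega)).1
    (by omega)
  simp only [weight, flow01, flow02, flow12]
  by_cases ha : 2 * n / 3 ≤ a
  · have hq : drain12 n (a + 1) b c = 0 := by
      simp (disch := omega) only [drain12, if_pos, if_neg]
    simp (disch := omega) only [if_pos, if_neg]
    refine add_nonneg (add_nonneg ?_ ?_) ?_ <;> apply slack_nonneg <;> intro k l <;>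
      fin_cases k <;> fin_cases l <;> simp <;> linarith
  by_cases hb : 2 * n / 3 ≤ b
  · have hp : drain02 n a (b + 1) c = 0 := by
      simp (disch := omega) only [drain02, if_pos]
    simp (disch := omega) only [if_pos, if_neg]
    refine add_nonneg (add_nonneg ?_ ?_) ?_ <;> apply slack_nonneg <;> intro k l <;>
      fin_cases k <;> fin_cases l <;> simp <;> linarith
  by_cases hc : 2 * n / 3 ≤ c
  · simp (disch := omega) only [if_pos, if_neg]
    refine add_nonneg (add_nonneg ?_ ?_) ?_ <;> apply slack_nonneg <;> intro k l <;>
      fin_cases k <;> fin_cases l <;> simp <;> linarith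
  · simp (disch := omega) only [if_pos, if_neg]
    -- Flow differences reach `4/3` on edges of weight `1`; a second cut edge of the triangle pays
    -- for the excess.
    fin_cases x <;> fin_cases y <;> fin_cases z <;> simp [slack] <;> linarith

theorem side_slack01_nonneg {n a b : ℕ} (hn : 10 ≤ n) (h : a + b + 1 = n) {k l : Fin 4}
    (hk : k = 0 ∨ k = 1) (hl : l = 0 ∨ l = 1) :
    0 ≤ slack (weight n a b 0) (flow01 n a b 0) k l := by
  have hf := floor_bounds n
  simp only [weight, flow01, sideFlow]
  generalize hm : 2 * n / 3 = m at *
  rcases lt_or_ge a m with ha | ha <;> rcases lt_or_ge b m with hb | hb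
  · simp (disch := omega) only [if_pos, if_neg]
    rcases hk with rfl | rfl <;> rcases hl with rfl | rfl <;>
      (simp [slack]; try linarith)
  · have hb' : (m : ℝ) ≤ b := by exact_mod_cast hb
    simp (disch := omega) only [if_pos, if_neg]
    rcases hk with rfl | rfl <;> rcases hl with rfl | rfl <;>
      (simp [slack]; try linarith)
  · have ha' : (m : ℝ) ≤ a := by exact_mod_cast ha
    simp (disch := omega) only [if_pos, if_neg]
    rcases hk with rfl | rfl <;> rcases hl with rfl | rfl <;>
      (simp [slack]; try linarith)
  · omega

/-- On a side ending at terminal `2` only three labels occur, with flows `s`, `0` and `p`. All their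
differences are at most `max s p`, hence at most `x + e`. -/
theorem neg_le_slack {x s p e : ℝ} {f : Fin 4 → ℝ} {i : Fin 4} (hi : i = 0 ∨ i = 1)
    (hf : f i = s) (hf2 : f 2 = 0) (hf3 : f 3 = p) (hs : 0 ≤ s) (hsx : s ≤ x)
    (hp : 0 ≤ p) (hpx : p ≤ x + e) (he : 0 ≤ e) {k l : Fin 4}
    (hk : k = i ∨ k = 2 ∨ k = 3) (hl : l = i ∨ l = 2 ∨ l = 3) : -e ≤ slack x f k l := by
  rcases hi with rfl | rfl <;>
  rcases hk with rfl | rfl | rfl <;> rcases hl with rfl | rfl | rfl <;>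
    simp [slack, hf, hf2, hf3] <;> linarith

/-- The edge with `c = k` leads into the corner of terminal `2`. Its weight `k + 1 - 2n/3` can be as
small as `1/3`, which the drain may exceed. -/
theorem neg_le_side_slack02 {n a c : ℕ} (hn : 10 ≤ n) (h : a + c + 1 = n) {k l : Fin 4}
    (hk : k = 0 ∨ k = 2 ∨ k = 3) (hl : l = 0 ∨ l = 2 ∨ l = 3) :
    -(if c = 2 * n / 3 then 1 / 3 else 0) ≤ slack (weight n a c 0) (flow02 n a 0 c) k l := by
  have hn' : (10 : ℝ) ≤ n := by exact_mod_cast hn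
  have hf := floor_bounds n
  have hκ : 2 / (3 * (n : ℝ)) * n = 2 / 3 := by field_simp
  have hκ0 : 0 < 2 / (3 * (n : ℝ)) := by positivity
  have hr : (a : ℝ) + c + 1 = n := by exact_mod_cast h
  refine neg_le_slack (i := 0) (s := sideFlow n a c) (p := drain02 n a 0 c) (Or.inl rfl) rfl rfl rfl
    ?_ ?_ ?_ ?_ ?_ hk hl <;>
  (try simp only [weight, sideFlow, drain02, if_true, true_and]) <;>
  generalize hm : 2 * n / 3 = m at * <;>
  generalize 2 / (3 * (n : ℝ)) = κ at * <;>
  (have h1 : κ ≤ 2 / 30 := by nlinarith) <;>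
  (have h2 : κ * m ≤ 4 / 9 := by nlinarith) <;>
  (have h3 : κ * a + κ * c + κ = 2 / 3 := by rw [← hκ, ← hr]; ring) <;>
  (have hc0 : 0 ≤ κ * c := by positivity) <;>
  (have hm0 : 0 ≤ κ * m := by positivity) <;>
  (have ha0 : 0 ≤ κ * a := by positivity) <;>
  (have hc0 : 0 ≤ (c : ℝ) := by positivity) <;>
  rcases lt_or_ge a m with ha | ha <;> rcases lt_trichotomy c m with hc | hc | hc <;>
  first
  | omega
  | (simp (disch := omega) only [if_pos, if_neg]
     try have ha' : (m : ℝ) ≤ a := by exact_mod_cast ha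
     try have ha'' : κ * m ≤ κ * a := by gcongr
     try have hc' : (m : ℝ) + 1 ≤ c := by exact_mod_cast hc
     try have hc' : (c : ℝ) + 1 ≤ m := by exact_mod_cast hc
     try have hc'' : κ * c ≤ κ * m := by gcongr
     try rw [hc]
     try rw [hc] at h3
     all_goals linarith)

set_option maxHeartbeats 800000 in
theorem neg_le_side_slack12 {n b c : ℕ} (hn : 10 ≤ n) (h : b + c + 1 = n) {k l : Fin 4}
    (hk : k = 1 ∨ k = 2 ∨ k = 3) (hl : l = 1 ∨ l = 2 ∨ l = 3) :
    -(if c = 2 * n / 3 then 1 / 3 else 0) ≤ slack (weight n b c 0) (flow12 n 0 b c) k l := by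
  have hn' : (10 : ℝ) ≤ n := by exact_mod_cast hn
  have hf := floor_bounds n
  have hκ : 2 / (3 * (n : ℝ)) * n = 2 / 3 := by field_simp
  have hκ0 : 0 < 2 / (3 * (n : ℝ)) := by positivity
  have hr : (b : ℝ) + c + 1 = n := by exact_mod_cast h
  refine neg_le_slack (i := 1) (s := sideFlow n b c) (p := drain12 n 0 b c) (Or.inr rfl) rfl rfl rfl
    ?_ ?_ ?_ ?_ ?_ hk hl <;>
  (try simp only [weight, sideFlow, drain12, if_true, true_and]) <;>
  generalize hm : 2 * n / 3 = m at * <;>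
  generalize 2 / (3 * (n : ℝ)) = κ at * <;>
  (have h1 : κ ≤ 2 / 30 := by nlinarith) <;>
  (have h2 : κ * m ≤ 4 / 9 := by nlinarith) <;>
  -- This product supplies a bound on `κ * m` finer than `h2`.
  (have h4 := mul_nonneg (sub_nonneg.2 h1) (sub_nonneg.2 hf.1)) <;>
  (have h3 : κ * b + κ * c + κ = 2 / 3 := by rw [← hκ, ← hr]; ring) <;>
  (have hc0 : 0 ≤ κ * c := by positivity) <;>
  (have hm0 : 0 ≤ κ * m := by positivity) <;>
  (have ha0 : 0 ≤ κ * b := by positivity) <;>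
  (have hc0 : 0 ≤ (c : ℝ) := by positivity) <;>
  rcases lt_or_ge b m with hb | hb <;> rcases lt_trichotomy c m with hc | hc | hc <;>
  rcases lt_trichotomy n (b + 1 + m) with hbn | hbn | hbn <;>
  first
  | omega
  | (simp (disch := omega) only [if_pos, if_neg]
     try have ha' : (m : ℝ) ≤ b := by exact_mod_cast hb
     try have ha' : (b : ℝ) + 1 ≤ m := by exact_mod_cast hb
     try have ha'' : κ * m ≤ κ * b := by gcongr
     try have ha'' := mul_le_mul_of_nonneg_left ha' hκ0.le
     try have hc' : (m : ℝ) + 1 ≤ c := by exact_mod_cast hc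
     try have hc' : (c : ℝ) + 1 ≤ m := by exact_mod_cast hc
     try have hc'' : κ * c ≤ κ * m := by gcongr
     try rw [hc]
     try rw [hc] at h3
     all_goals linarith)

/-! ### Global summation. -/

/-- Terminals `0` and `1` give `2n/3` each, and the `2k + 1 - n` middle nodes of their side give `2`
each. The node with `b = k` gives `k + 1 - 2n/3` less, since the side flows of labels `0` and `1`
both end there. -/
theorem sum_supply {n : ℕ} (hn : 10 ≤ n) :
    ∑ u ∈ tri n, supply n u.1 u.2.1 u.2.2 = 3 * ((2 * n / 3 : ℕ) : ℝ) + 1 := by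
  obtain ⟨k, hk⟩ : ∃ k, k = 2 * n / 3 := ⟨_, rfl⟩
  have h1 : ∑ u ∈ tri n, supply n u.1 u.2.1 u.2.2 =
      ∑ b ∈ Finset.range (n + 1), supply n (n - b) b 0 := by
    rw [← Finset.sum_filter_of_ne (p := fun u => u.2.2 = 0)]
    · refine Finset.sum_nbij' (fun u => u.2.1) (fun b => (n - b, b, 0)) ?_ ?_ ?_ ?_ ?_
      · rintro ⟨a, b, c⟩; simp only [Finset.mem_filter, mem_tri, Finset.mem_range]; omega
      · intro b hb
        rw [Finset.mem_range] at hb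
        exact Finset.mem_filter.2 ⟨mem_tri.2 (by dsimp only; omega), rfl⟩
      · rintro ⟨a, b, c⟩ hu
        simp only [Finset.mem_filter, mem_tri, Prod.mk.injEq, true_and] at hu ⊢
        omega
      · simp
      · rintro ⟨a, b, c⟩
        simp only [Finset.mem_filter, mem_tri]
        rintro ⟨h, rfl⟩
        rw [show n - b = a by omega]
    · intro u _ hu
      by_contra h
      exact hu (by simp [supply, h])
  have h2 : ∀ b ∈ Finset.range (n + 1), supply n (n - b) b 0 =
      (if b = 0 then 2 * (n : ℝ) / 3 else 0) + (if b = n then 2 * (n : ℝ) / 3 else 0) +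
      (if b = k then 2 * (n : ℝ) / 3 - k - 1 else 0) +
      (if b ∈ Finset.Icc (n - k) k then 2 else 0) := by
    intro b hb
    rw [Finset.mem_range] at hb
    simp only [supply, Finset.mem_Icc, ← hk]
    rcases Nat.eq_zero_or_pos b with h | h <;> rcases eq_or_ne b n with h' | h' <;>
      rcases lt_trichotomy b k with h'' | h'' | h'' <;> rcases lt_or_ge b (n - k) with h3 | h3 <;>
    first
    | omega
    | (simp (disch := omega) only [if_pos, if_neg]
       try ring)
  rw [h1, Finset.sum_congr rfl h2]
  simp only [Finset.sum_add_distrib, Finset.sum_ite_eq', Finset.mem_range]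
  rw [← Finset.sum_filter, Finset.sum_const, show (Finset.range (n + 1)).filter
    (fun b => b ∈ Finset.Icc (n - k) k) = Finset.Icc (n - k) k by
      ext b; simp only [Finset.mem_filter, Finset.mem_range, Finset.mem_Icc]; omega,
    Nat.card_Icc, if_pos (by omega), if_pos (by omega), if_pos (by omega), nsmul_eq_mul,
    show k + 1 - (n - k) = 2 * k + 1 - n by omega, Nat.cast_sub (by omega), ← hk]
  push_cast
  ring

/-- The cost of the cut edges, in units of `ρ`, among the three edges with base point `w`. -/
noncomputable def cutWeight (n : ℕ) (q : ℕ → ℕ → ℕ → Fin 4) (a b c : ℕ) : ℝ :=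
  (if q (a + 1) b c = q a (b + 1) c then 0 else weight n a b c) +
  (if q (a + 1) b c = q a b (c + 1) then 0 else weight n a c b) +
  (if q a (b + 1) c = q a b (c + 1) then 0 else weight n b c a)

theorem sum_flow_eq_sum_divergence (m : ℕ) (q : ℕ → ℕ → ℕ → Fin 4) :
    ∑ w ∈ tri m,
      ((flow01 (m + 1) w.1 w.2.1 w.2.2 (q (w.1 + 1) w.2.1 w.2.2) -
          flow01 (m + 1) w.1 w.2.1 w.2.2 (q w.1 (w.2.1 + 1) w.2.2)) +
        (flow02 (m + 1) w.1 w.2.1 w.2.2 (q (w.1 + 1) w.2.1 w.2.2) -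
          flow02 (m + 1) w.1 w.2.1 w.2.2 (q w.1 w.2.1 (w.2.2 + 1))) +
        (flow12 (m + 1) w.1 w.2.1 w.2.2 (q w.1 (w.2.1 + 1) w.2.2) -
          flow12 (m + 1) w.1 w.2.1 w.2.2 (q w.1 w.2.1 (w.2.2 + 1)))) =
    ∑ u ∈ tri (m + 1), divergence (m + 1) u.1 u.2.1 u.2.2 (q u.1 u.2.1 u.2.2) := by
  have e0 := sum_tri_fst m fun a b c => if a = 0 then 0 else
    flow01 (m + 1) (a - 1) b c (q a b c) + flow02 (m + 1) (a - 1) b c (q a b c)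
  have e1 := sum_tri_snd m fun a b c => if b = 0 then 0 else
    flow12 (m + 1) a (b - 1) c (q a b c) - flow01 (m + 1) a (b - 1) c (q a b c)
  have e2 := sum_tri_trd m fun a b c => if c = 0 then 0 else
    -flow02 (m + 1) a b (c - 1) (q a b c) - flow12 (m + 1) a b (c - 1) (q a b c)
  -- The boundary terms vanish because `divergence` omits edges whose base point would leave the
  -- triangle.
  have filter_zero : ∀ (p : ℕ × ℕ × ℕ → Prop) [DecidablePred p] (f : ℕ × ℕ × ℕ → ℝ),
      ∑ u ∈ (tri (m + 1)).filter p, (if p u then 0 else f u) = 0 := fun p _ f =>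
    Finset.sum_eq_zero fun u hu => if_pos (Finset.mem_filter.1 hu).2
  rw [filter_zero (fun u => u.1 = 0), zero_add] at e0
  rw [filter_zero (fun u => u.2.1 = 0), zero_add] at e1
  rw [filter_zero (fun u => u.2.2 = 0), zero_add] at e2
  simp only [divergence, Finset.sum_add_distrib, e0, e1, e2]
  simp only [Nat.add_sub_cancel, Nat.add_eq_zero_iff, one_ne_zero, and_false, if_false,
    ← Finset.sum_add_distrib]
  exact Finset.sum_congr rfl fun w _ => by ring

/-- A side has only one base point with last coordinate `k`, so it loses `1/3` only once. -/
theorem neg_le_sum_filter {s : Finset (ℕ × ℕ × ℕ)} {p : ℕ × ℕ × ℕ → Prop}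
    [DecidablePred p] {f : ℕ × ℕ × ℕ → ℝ} {k : ℕ} {u : ℕ × ℕ × ℕ}
    (hf : ∀ w ∈ s.filter p, -(if w.2.2 = k then 1 / 3 else 0) ≤ f w)
    (hu : ∀ w ∈ s.filter p, w.2.2 = k → w = u) :
    -(1 / 3) ≤ ∑ w ∈ s.filter p, f w := by
  refine le_trans ?_ (Finset.sum_le_sum hf)
  rw [Finset.sum_neg_distrib, neg_le_neg_iff, ← Finset.sum_filter, Finset.sum_const]
  have : ((s.filter p).filter fun w => w.2.2 = k).card ≤ 1 := by
    refine Finset.card_le_one.2 fun x hx y hy => ?_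
    rw [Finset.mem_filter] at hx hy
    rw [hu x hx.1 hx.2, hu y hy.1 hy.2]
  have : (((s.filter p).filter fun w => w.2.2 = k).card : ℝ) ≤ 1 := by exact_mod_cast this
  rw [nsmul_eq_mul]
  linarith

theorem le_sum_cutWeight {m : ℕ} (hm : 8 ≤ m) (q : ℕ → ℕ → ℕ → Fin 4)
    (h0 : ∀ a b c, a + b + c = m + 2 → q a b c = 0 → 0 < a)
    (h1 : ∀ a b c, a + b + c = m + 2 → q a b c = 1 → 0 < b)
    (h2 : ∀ a b c, a + b + c = m + 2 → q a b c = 2 → 0 < c)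
    (h3 : ∀ a b c, a + b + c = m + 2 → q a b c = 3 → 0 < c)
    (hq : q 0 0 (m + 2) = 2) :
    2 * ((m + 2 : ℕ) : ℝ) - 5 / 3 + 2 / (3 * ((m + 2 : ℕ) : ℝ)) *
        ((tri (m + 2)).filter fun u => q u.1 u.2.1 u.2.2 = 3).card ≤
      ∑ w ∈ tri (m + 1), cutWeight (m + 2) q w.1 w.2.1 w.2.2 := by
  have hcases : ∀ l : Fin 4, l = 0 ∨ l = 1 ∨ l = 2 ∨ l = 3 := by decide
  have hdiv : ∑ u ∈ tri (m + 2), (supply (m + 2) u.1 u.2.1 u.2.2 +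
      if q u.1 u.2.1 u.2.2 = 3 then 2 / (3 * ((m + 2 : ℕ) : ℝ)) else 0) ≤
      ∑ u ∈ tri (m + 2), divergence (m + 2) u.1 u.2.1 u.2.2 (q u.1 u.2.1 u.2.2) := by
    refine Finset.sum_le_sum fun ⟨a, b, c⟩ hu => ?_
    rw [mem_tri] at hu
    dsimp only at hu ⊢
    rcases hcases (q a b c) with h | h | h | h <;> rw [h]
    · simpa using supply_le_divergence_zero (by omega) hu (h0 a b c hu h)
    · simpa using supply_le_divergence_one (by omega) hu (h1 a b c hu h)
    · simpa using supply_le_divergence_two (h2 a b c hu h)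
    · have hc := h3 a b c hu h
      rw [if_pos rfl]
      refine supply_add_le_divergence_three (by omega) hu hc (lt_of_le_of_ne (by omega) ?_)
      intro hcn
      obtain ⟨rfl, rfl⟩ : a = 0 ∧ b = 0 := by omega
      rw [hcn, hq] at h
      exact absurd h (by decide)
  rw [Finset.sum_add_distrib, sum_supply (by omega), ← Finset.sum_filter, Finset.sum_const,
    ← sum_flow_eq_sum_divergence (m + 1) q, nsmul_eq_mul] at hdiv
  have hslack : -(2 / 3) ≤ ∑ w ∈ tri (m + 1),
      (slack (weight (m + 2) w.1 w.2.1 w.2.2) (flow01 (m + 2) w.1 w.2.1 w.2.2)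
          (q (w.1 + 1) w.2.1 w.2.2) (q w.1 (w.2.1 + 1) w.2.2) +
        slack (weight (m + 2) w.1 w.2.2 w.2.1) (flow02 (m + 2) w.1 w.2.1 w.2.2)
          (q (w.1 + 1) w.2.1 w.2.2) (q w.1 w.2.1 (w.2.2 + 1)) +
        slack (weight (m + 2) w.2.1 w.2.2 w.1) (flow12 (m + 2) w.1 w.2.1 w.2.2)
          (q w.1 (w.2.1 + 1) w.2.2) (q w.1 w.2.1 (w.2.2 + 1))) := by
    have e0 := sum_tri_trd m fun a b c => slack (weight (m + 2) a b c) (flow01 (m + 2) a b c)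
      (q (a + 1) b c) (q a (b + 1) c)
    have e1 := sum_tri_snd m fun a b c => slack (weight (m + 2) a c b) (flow02 (m + 2) a b c)
      (q (a + 1) b c) (q a b (c + 1))
    have e2 := sum_tri_fst m fun a b c => slack (weight (m + 2) b c a) (flow12 (m + 2) a b c)
      (q a (b + 1) c) (q a b (c + 1))
    have hd := Finset.sum_nonneg fun (v : ℕ × ℕ × ℕ) (hv : v ∈ tri m) =>
      down_slack_nonneg (n := m + 2) (a := v.1) (b := v.2.1) (c := v.2.2) (by omega)
        (by rw [mem_tri] at hv; omega) (q v.1 (v.2.1 + 1) (v.2.2 + 1))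
        (q (v.1 + 1) v.2.1 (v.2.2 + 1)) (q (v.1 + 1) (v.2.1 + 1) v.2.2)
    have s0 : 0 ≤ ∑ w ∈ (tri (m + 1)).filter (fun u => u.2.2 = 0),
        slack (weight (m + 2) w.1 w.2.1 w.2.2) (flow01 (m + 2) w.1 w.2.1 w.2.2)
          (q (w.1 + 1) w.2.1 w.2.2) (q w.1 (w.2.1 + 1) w.2.2) := by
      refine Finset.sum_nonneg ?_
      rintro ⟨a, b, c⟩ hw
      simp only [Finset.mem_filter, mem_tri] at hw ⊢
      obtain ⟨hw, rfl⟩ := hw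
      have key : ∀ x y, x + y + 0 = m + 2 → q x y 0 = 0 ∨ q x y 0 = 1 := fun x y hxy => by
        rcases hcases (q x y 0) with h | h | h | h
        · exact Or.inl h
        · exact Or.inr h
        · exact absurd (h2 _ _ _ hxy h) (lt_irrefl _)
        · exact absurd (h3 _ _ _ hxy h) (lt_irrefl _)
      exact side_slack01_nonneg (by omega) (by omega) (key _ _ (by omega)) (key _ _ (by omega))
    have s1 : -(1 / 3) ≤ ∑ w ∈ (tri (m + 1)).filter (fun u => u.2.1 = 0),
        slack (weight (m + 2) w.1 w.2.2 w.2.1) (flow02 (m + 2) w.1 w.2.1 w.2.2)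
          (q (w.1 + 1) w.2.1 w.2.2) (q w.1 w.2.1 (w.2.2 + 1)) := by
      refine neg_le_sum_filter (k := 2 * (m + 2) / 3)
        (u := (m + 1 - 2 * (m + 2) / 3, 0, 2 * (m + 2) / 3)) ?_ ?_
      · rintro ⟨a, b, c⟩ hw
        simp only [Finset.mem_filter, mem_tri] at hw ⊢
        obtain ⟨hw, rfl⟩ := hw
        have key : ∀ x y, x + 0 + y = m + 2 → q x 0 y = 0 ∨ q x 0 y = 2 ∨ q x 0 y = 3 :=
          fun x y hxy => by
            rcases hcases (q x 0 y) with h | h | h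
            · exact Or.inl h
            · exact absurd (h1 _ _ _ hxy h) (lt_irrefl _)
            · exact Or.inr h
        exact neg_le_side_slack02 (by omega) (by omega) (key _ _ (by omega)) (key _ _ (by omega))
      · rintro ⟨a, b, c⟩ hw
        simp only [Finset.mem_filter, mem_tri, Prod.mk.injEq] at hw ⊢
        omega
    have s2 : -(1 / 3) ≤ ∑ w ∈ (tri (m + 1)).filter (fun u => u.1 = 0),
        slack (weight (m + 2) w.2.1 w.2.2 w.1) (flow12 (m + 2) w.1 w.2.1 w.2.2)
          (q w.1 (w.2.1 + 1) w.2.2) (q w.1 w.2.1 (w.2.2 + 1)) := by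
      refine neg_le_sum_filter (k := 2 * (m + 2) / 3)
        (u := (0, m + 1 - 2 * (m + 2) / 3, 2 * (m + 2) / 3)) ?_ ?_
      · rintro ⟨a, b, c⟩ hw
        simp only [Finset.mem_filter, mem_tri] at hw ⊢
        obtain ⟨hw, rfl⟩ := hw
        have key : ∀ x y, 0 + x + y = m + 2 → q 0 x y = 1 ∨ q 0 x y = 2 ∨ q 0 x y = 3 :=
          fun x y hxy => by
            rcases hcases (q 0 x y) with h | h
            · exact absurd (h0 _ _ _ hxy h) (lt_irrefl _)
            · exact h
        exact neg_le_side_slack12 (by omega) (by omega) (key _ _ (by omega)) (key _ _ (by omega))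
      · rintro ⟨a, b, c⟩ hw
        simp only [Finset.mem_filter, mem_tri, Prod.mk.injEq] at hw ⊢
        omega
    simp only [Finset.sum_add_distrib] at hd ⊢
    linarith
  have hsum := Finset.sum_congr rfl fun (w : ℕ × ℕ × ℕ) (_ : w ∈ tri (m + 1)) =>
    show cutWeight (m + 2) q w.1 w.2.1 w.2.2 =
      (slack (weight (m + 2) w.1 w.2.1 w.2.2) (flow01 (m + 2) w.1 w.2.1 w.2.2)
          (q (w.1 + 1) w.2.1 w.2.2) (q w.1 (w.2.1 + 1) w.2.2) +
        slack (weight (m + 2) w.1 w.2.2 w.2.1) (flow02 (m + 2) w.1 w.2.1 w.2.2)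
          (q (w.1 + 1) w.2.1 w.2.2) (q w.1 w.2.1 (w.2.2 + 1)) +
        slack (weight (m + 2) w.2.1 w.2.2 w.1) (flow12 (m + 2) w.1 w.2.1 w.2.2)
          (q w.1 (w.2.1 + 1) w.2.2) (q w.1 w.2.1 (w.2.2 + 1))) +
      ((flow01 (m + 2) w.1 w.2.1 w.2.2 (q (w.1 + 1) w.2.1 w.2.2) -
          flow01 (m + 2) w.1 w.2.1 w.2.2 (q w.1 (w.2.1 + 1) w.2.2)) +
        (flow02 (m + 2) w.1 w.2.1 w.2.2 (q (w.1 + 1) w.2.1 w.2.2) -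
          flow02 (m + 2) w.1 w.2.1 w.2.2 (q w.1 w.2.1 (w.2.2 + 1))) +
        (flow12 (m + 2) w.1 w.2.1 w.2.2 (q w.1 (w.2.1 + 1) w.2.2) -
          flow12 (m + 2) w.1 w.2.1 w.2.2 (q w.1 w.2.1 (w.2.2 + 1)))) by
      rw [cutWeight, slack, slack, slack]; ring
  rw [hsum, Finset.sum_add_distrib]
  -- From `3k ≥ 2n - 2` one gets `3k + 1 - 2/3 ≥ 2n - 5/3`.
  have hf := floor_bounds (m + 2)
  linarith

/-! ### Transfer to the instance `J`. -/

/-- An endpoint coordinate `a + 1` exceeds `2n/3` exactly when `k ≤ a`, whereas the unchanged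
coordinate `c` does so exactly when `k < c`; hence the two kinds of threshold in `weight`. -/
theorem relCost_eq_weight {n : ℕ} (hn : 10 ≤ n) {i j k : Fin 3} (hij : i ≠ j) (hik : i ≠ k)
    (hjk : j ≠ k) {x y : Node n} {a b c : ℕ} (h : a + b + c + 1 = n)
    (hxi : x.1 i = a + 1) (hxj : x.1 j = b) (hxk : x.1 k = c)
    (hyi : y.1 i = a) (hyj : y.1 j = b + 1) (hyk : y.1 k = c) (hxy : (grid n).Adj x y) :
    relCost x y = weight n a b c := by
  have hcov : ∀ l : Fin 3, l = i ∨ l = j ∨ l = k :=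
    (by decide : ∀ i j k : Fin 3, i ≠ j → i ≠ k → j ≠ k → ∀ l, l = i ∨ l = j ∨ l = k)
      i j k hij hik hjk
  have hx : InHexagon x ↔ 3 * (a + 1) ≤ 2 * n ∧ 3 * b ≤ 2 * n ∧ 3 * c ≤ 2 * n := by
    constructor
    · intro h; exact ⟨hxi ▸ h i, hxj ▸ h j, hxk ▸ h k⟩
    · rintro ⟨h1, h2, h3⟩ l
      rcases hcov l with rfl | rfl | rfl
      · rwa [hxi]
      · rwa [hxj]
      · rwa [hxk]
  have hy : InHexagon y ↔ 3 * a ≤ 2 * n ∧ 3 * (b + 1) ≤ 2 * n ∧ 3 * c ≤ 2 * n := by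
    constructor
    · intro h; exact ⟨hyi ▸ h i, hyj ▸ h j, hyk ▸ h k⟩
    · rintro ⟨h1, h2, h3⟩ l
      rcases hcov l with rfl | rfl | rfl
      · rwa [hyi]
      · rwa [hyj]
      · rwa [hyk]
  have hside : (∃ i j, i ≠ j ∧ s(x, y) ∈ sideEdges n i j) ↔ c = 0 := by
    simp only [sideEdges, Finset.mem_filter, SimpleGraph.mem_edgeFinset, SimpleGraph.mem_edgeSet,
      Sym2.mem_iff, forall_eq_or_imp, forall_eq, hxy, true_and]
    constructor
    · rintro ⟨i', j', -, h1, h2⟩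
      by_contra hc
      have mi : i ∈ ({i', j'} : Finset (Fin 3)) := h1 (by simp [support, hxi])
      have mj : j ∈ ({i', j'} : Finset (Fin 3)) := h2 (by simp [support, hyj])
      have mk : k ∈ ({i', j'} : Finset (Fin 3)) := h1 (by simp [support, hxk, hc])
      simp only [Finset.mem_insert, Finset.mem_singleton] at mi mj mk
      rcases mi with rfl | rfl <;> rcases mj with rfl | rfl <;> rcases mk with rfl | rfl <;>
        contradiction
    · rintro rfl
      refine ⟨i, j, hij, fun l hl => ?_, fun l hl => ?_⟩ <;>
      rcases hcov l with rfl | rfl | rfl <;> simp_all [support]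
  have hcorner : (∃ l, (InCorner l x ∧ InCorner l y) ∧ x.1 l = y.1 l) ↔ 2 * n < 3 * c := by
    constructor
    · rintro ⟨l, ⟨h1, -⟩, h2⟩
      rcases hcov l with rfl | rfl | rfl
      · omega
      · omega
      · rwa [InCorner, hxk] at h1
    · intro h1
      exact ⟨k, ⟨by rwa [InCorner, hxk], by rwa [InCorner, hyk]⟩, by rw [hxk, hyk]⟩
  have hrank : c = 0 → rankFromCorner x y = n - max (a + 1) (b + 1) := by
    rintro rfl
    rw [rankFromCorner]
    congr 1
    apply le_antisymm
    · refine Finset.sup_le fun l _ => ?_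
      rcases hcov l with rfl | rfl | rfl <;> omega
    · refine max_le ?_ ?_
      · exact le_trans (by omega)
          (Finset.le_sup (f := fun i => max (x.1 i) (y.1 i)) (Finset.mem_univ i))
      · exact le_trans (by omega)
          (Finset.le_sup (f := fun i => max (x.1 i) (y.1 i)) (Finset.mem_univ j))
  rw [relCost, weight]
  simp only [hx, hy, hside, hcorner]
  by_cases hc : c = 0
  · rw [hrank hc]
    have hr : (a : ℝ) + b + 1 = n := by exact_mod_cast (by omega : a + b + 1 = n)
    rcases lt_or_ge a (2 * n / 3) with ha | ha <;> rcases lt_or_ge b (2 * n / 3) with hb | hb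
    · simp (disch := omega) only [if_pos, if_neg]
    · simp (disch := omega) only [if_pos, if_neg, max_eq_right]
      rw [show n - (b + 1) = a by omega]
      linarith
    · simp (disch := omega) only [if_pos, if_neg, max_eq_left]
      rw [show n - (a + 1) = b by omega]
      linarith
    · omega
  · rcases lt_or_ge (2 * n / 3) c with h' | h' <;>
    rcases lt_or_ge a (2 * n / 3) with ha | ha <;> rcases lt_or_ge b (2 * n / 3) with hb | hb <;>
    first
    | omega
    | simp (disch := omega) only [if_pos, if_neg]

theorem relCost_nonneg {n : ℕ} (x y : Node n) : 0 ≤ relCost x y := by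
  rw [relCost]
  split_ifs with h1 h2 h3
  · exact zero_le_one
  · have : ∃ i, 2 * n < 3 * max (x.1 i) (y.1 i) := by
      by_contra! h
      exact h1 ⟨fun i => by have := h i; omega, fun i => by have := h i; omega⟩
    obtain ⟨i, hi⟩ := this
    have hs := Finset.le_sup (f := fun i => max (x.1 i) (y.1 i)) (Finset.mem_univ i)
    have hr : 3 * rankFromCorner x y ≤ n := by
      rw [rankFromCorner]; omega
    have : (3 : ℝ) * rankFromCorner x y ≤ n := by exact_mod_cast hr
    linarith
  · exact le_rfl
  · exact zero_le_one

/-- The node with coordinates `a`, `b`, `c` at `σ 0`, `σ 1`, `σ 2`. -/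
def node (n : ℕ) (σ : Equiv.Perm (Fin 3)) (a b c : ℕ) : Node n :=
  if h : a + b + c = n then
    ⟨fun i => ![a, b, c] (σ.symm i), by
      rw [Equiv.sum_comp σ.symm, Fin.sum_univ_three]; exact h⟩
  -- A junk value: only triples with sum `n` matter.
  else terminal n 0

theorem node_val {n : ℕ} {σ : Equiv.Perm (Fin 3)} {a b c : ℕ} (h : a + b + c = n) (i : Fin 3) :
    (node n σ a b c).1 (σ i) = ![a, b, c] i := by
  simp [node, h]

theorem node_inj {n : ℕ} {σ : Equiv.Perm (Fin 3)} {a b c a' b' c' : ℕ} (h : a + b + c = n)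
    (h' : a' + b' + c' = n) :
    node n σ a b c = node n σ a' b' c' ↔ a = a' ∧ b = b' ∧ c = c' := by
  constructor
  · intro he
    have hi : ∀ i, ![a, b, c] i = ![a', b', c'] i := fun i => by
      rw [← node_val h, ← node_val h', he]
    exact ⟨hi 0, hi 1, hi 2⟩
  · rintro ⟨rfl, rfl, rfl⟩; rfl

theorem grid_adj_iff {n : ℕ} (σ : Equiv.Perm (Fin 3)) {x y : Node n} :
    (grid n).Adj x y ↔ |(x.1 (σ 0) : ℤ) - y.1 (σ 0)| + |(x.1 (σ 1) : ℤ) - y.1 (σ 1)| +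
      |(x.1 (σ 2) : ℤ) - y.1 (σ 2)| = 2 := by
  rw [← Fin.sum_univ_three fun i => |(x.1 (σ i) : ℤ) - y.1 (σ i)|,
    Equiv.sum_comp σ fun i => |(x.1 i : ℤ) - y.1 i|]
  rfl

/-- The three edges of the grid between the nodes `w + eᵢ`. -/
def baseEdge (n : ℕ) (σ : Equiv.Perm (Fin 3)) (w : ℕ × ℕ × ℕ) : Fin 3 → Sym2 (Node n) :=
  ![s(node n σ (w.1 + 1) w.2.1 w.2.2, node n σ w.1 (w.2.1 + 1) w.2.2),
    s(node n σ (w.1 + 1) w.2.1 w.2.2, node n σ w.1 w.2.1 (w.2.2 + 1)),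
    s(node n σ w.1 (w.2.1 + 1) w.2.2, node n σ w.1 w.2.1 (w.2.2 + 1))]

/-- An edge determines its upward triangle, so summing over base points counts no edge twice. -/
theorem baseEdge_injective {m : ℕ} {σ : Equiv.Perm (Fin 3)} {w w' : ℕ × ℕ × ℕ} (hw : w ∈ tri m)
    (hw' : w' ∈ tri m) {k k' : Fin 3} (h : baseEdge (m + 1) σ w k = baseEdge (m + 1) σ w' k') :
    w = w' ∧ k = k' := by
  obtain ⟨a, b, c⟩ := w
  obtain ⟨a', b', c'⟩ := w'
  rw [mem_tri] at hw hw'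
  dsimp only at hw hw'
  fin_cases k <;> fin_cases k' <;>
  · simp only [baseEdge, Fin.zero_eta, Fin.mk_one, Fin.reduceFinMk, Matrix.cons_val, Sym2.eq_iff]
      at h
    simp (disch := omega) only [node_inj] at h
    simp only [Prod.mk.injEq, and_true]
    omega

theorem mk_mem_cutSet {n : ℕ} {Q : Node n → Fin 4} {x y : Node n} :
    s(x, y) ∈ cutSet Q ↔ (grid n).Adj x y ∧ Q x ≠ Q y := by
  simp [cutSet]

/-- The labels renumbered along a permutation of the terminals. -/
def relabel (σ : Equiv.Perm (Fin 3)) (l : Fin 4) : Fin 4 :=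
  Fin.lastCases (Fin.last 3) (fun i => (σ.symm i).castSucc) l

theorem relabel_last (σ : Equiv.Perm (Fin 3)) : relabel σ (Fin.last 3) = Fin.last 3 := by
  rw [relabel, Fin.lastCases_last]

theorem relabel_castSucc (σ : Equiv.Perm (Fin 3)) (i : Fin 3) :
    relabel σ i.castSucc = (σ.symm i).castSucc := by
  rw [relabel, Fin.lastCases_castSucc]

theorem relabel_injective (σ : Equiv.Perm (Fin 3)) : Function.Injective (relabel σ) := by
  intro k l h
  induction k using Fin.lastCases with
  | last =>
    induction l using Fin.lastCases with
    | last => rfl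
    | cast j =>
      rw [relabel_last, relabel_castSucc] at h
      exact absurd h.symm (Fin.castSucc_ne_last _)
  | cast i =>
    induction l using Fin.lastCases with
    | last =>
      rw [relabel_last, relabel_castSucc] at h
      exact absurd h (Fin.castSucc_ne_last _)
    | cast j =>
      rw [relabel_castSucc, relabel_castSucc, Fin.castSucc_inj, σ.symm.injective.eq_iff] at h
      rw [h]

/-- The renumbered label of a node in the coordinates given by `σ`. -/
def label {n : ℕ} (σ : Equiv.Perm (Fin 3)) (Q : Node n → Fin 4) (a b c : ℕ) : Fin 4 :=
  relabel σ (Q (node n σ a b c))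

theorem label_eq_last_iff {n : ℕ} {σ : Equiv.Perm (Fin 3)} {Q : Node n → Fin 4} {a b c : ℕ} :
    label σ Q a b c = 3 ↔ Q (node n σ a b c) = Fin.last 3 := by
  rw [label, show (3 : Fin 4) = relabel σ (Fin.last 3) from (relabel_last σ).symm,
    (relabel_injective σ).eq_iff]

theorem ne_zero_of_label_eq {n : ℕ} {σ : Equiv.Perm (Fin 3)} {Q : Node n → Fin 4}
    (hQ : IsNonOpposite Q) {a b c : ℕ} (h : a + b + c = n) {i : Fin 3}
    (hi : label σ Q a b c = i.castSucc) : ![a, b, c] i ≠ 0 := by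
  rcases hQ.2 (node n σ a b c) with ⟨j, hj, hQj⟩ | hl
  · rw [label, hQj, relabel_castSucc, Fin.castSucc_inj] at hi
    rw [← node_val (n := n) (σ := σ) h, ← hi, Equiv.apply_symm_apply]
    exact (Finset.mem_filter.1 hj).2
  · rw [label, hl, relabel_last] at hi
    exact absurd hi.symm (Fin.castSucc_ne_last i)

theorem node_terminal (n : ℕ) (σ : Equiv.Perm (Fin 3)) {a b c : ℕ} (h : a + b + c = n) {i : Fin 3}
    (hi : ![a, b, c] i = n) : node n σ a b c = terminal n (σ i) := by
  have key : ∀ j, (node n σ a b c).1 (σ j) = (terminal n (σ i)).1 (σ j) := by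
    intro j
    rw [node_val h]
    rcases eq_or_ne j i with rfl | hj
    · simp [terminal, hi]
    · change _ = (Pi.single (σ i) n : Fin 3 → ℕ) (σ j)
      rw [Pi.single_eq_of_ne (σ.injective.ne hj)]
      revert hi hj
      fin_cases i <;> fin_cases j <;> simp <;> omega
  ext j
  simpa using key (σ.symm j)

theorem label_terminal {n : ℕ} {σ : Equiv.Perm (Fin 3)} {Q : Node n → Fin 4} (hQ : IsCut Q)
    {a b c : ℕ} (h : a + b + c = n) {i : Fin 3} (hi : ![a, b, c] i = n) :
    label σ Q a b c = i.castSucc := by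
  rw [label, node_terminal n σ h hi, hQ, relabel_castSucc, Equiv.symm_apply_apply]

theorem baseEdge_adj {m : ℕ} {σ : Equiv.Perm (Fin 3)} {a b c : ℕ} (h : a + b + c = m) :
    (grid (m + 1)).Adj (node (m + 1) σ (a + 1) b c) (node (m + 1) σ a (b + 1) c) ∧
    (grid (m + 1)).Adj (node (m + 1) σ (a + 1) b c) (node (m + 1) σ a b (c + 1)) ∧
    (grid (m + 1)).Adj (node (m + 1) σ a (b + 1) c) (node (m + 1) σ a b (c + 1)) := by
  simp (disch := omega) only [grid_adj_iff σ, node_val, Matrix.cons_val]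
  simp

/-- The cost of an edge in units of `ρ`. -/
noncomputable def edgeRelCost {n : ℕ} (e : Sym2 (Node n)) : ℝ :=
  Sym2.lift ⟨relCost, relCost_comm⟩ e

theorem cutWeight_eq {m : ℕ} (hm : 9 ≤ m) (σ : Equiv.Perm (Fin 3)) (Q : Node (m + 1) → Fin 4)
    {w : ℕ × ℕ × ℕ} (hw : w ∈ tri m) :
    cutWeight (m + 1) (label σ Q) w.1 w.2.1 w.2.2 = ∑ k : Fin 3,
      if baseEdge (m + 1) σ w k ∈ cutSet Q then edgeRelCost (baseEdge (m + 1) σ w k) else 0 := by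
  obtain ⟨a, b, c⟩ := w
  rw [mem_tri] at hw
  dsimp only at hw
  obtain ⟨h0, h1, h2⟩ := baseEdge_adj (σ := σ) hw
  have n01 : σ 0 ≠ σ 1 := σ.injective.ne (by decide)
  have n02 : σ 0 ≠ σ 2 := σ.injective.ne (by decide)
  have n12 : σ 1 ≠ σ 2 := σ.injective.ne (by decide)
  have v0 : (node (m + 1) σ (a + 1) b c).1 (σ 0) = a + 1 ∧
      (node (m + 1) σ (a + 1) b c).1 (σ 1) = b ∧ (node (m + 1) σ (a + 1) b c).1 (σ 2) = c := by
    simp (disch := omega) [node_val]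
  have v1 : (node (m + 1) σ a (b + 1) c).1 (σ 0) = a ∧
      (node (m + 1) σ a (b + 1) c).1 (σ 1) = b + 1 ∧ (node (m + 1) σ a (b + 1) c).1 (σ 2) = c := by
    simp (disch := omega) [node_val]
  have v2 : (node (m + 1) σ a b (c + 1)).1 (σ 0) = a ∧
      (node (m + 1) σ a b (c + 1)).1 (σ 1) = b ∧ (node (m + 1) σ a b (c + 1)).1 (σ 2) = c + 1 := by
    simp (disch := omega) [node_val]
  have r0 := relCost_eq_weight (by omega) n01 n02 n12 (by omega) v0.1 v0.2.1 v0.2.2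
    v1.1 v1.2.1 v1.2.2 h0
  have r1 := relCost_eq_weight (by omega) n02 n01 n12.symm (by omega) v0.1 v0.2.2 v0.2.1
    v2.1 v2.2.2 v2.2.1 h1
  have r2 := relCost_eq_weight (by omega) n12 n01.symm n02.symm (by omega) v1.2.1 v1.2.2 v1.1
    v2.2.1 v2.2.2 v2.1 h2
  simp only [Fin.sum_univ_three, cutWeight, baseEdge, Matrix.cons_val, mk_mem_cutSet, edgeRelCost,
    Sym2.lift_mk, h0, h1, h2, r0, r1, r2, true_and, label, (relabel_injective σ).eq_iff, ne_eq,
    ite_not]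

theorem sum_cutWeight_le {m : ℕ} (hm : 9 ≤ m) (σ : Equiv.Perm (Fin 3))
    (Q : Node (m + 1) → Fin 4) :
    ∑ w ∈ tri m, cutWeight (m + 1) (label σ Q) w.1 w.2.1 w.2.2 ≤
      ∑ e ∈ cutSet Q, edgeRelCost e := by
  rw [Finset.sum_congr rfl fun w hw => cutWeight_eq hm σ Q hw, ← Finset.sum_product',
    ← Finset.sum_filter]
  rw [← Finset.sum_image (g := fun p : (ℕ × ℕ × ℕ) × Fin 3 => baseEdge (m + 1) σ p.1 p.2)
    (f := edgeRelCost)]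
  -- Nonnegative costs make it unnecessary to show that every cut edge has a base point.
  · refine Finset.sum_le_sum_of_subset_of_nonneg ?_ fun e _ _ => ?_
    · intro e he
      obtain ⟨p, hp, rfl⟩ := Finset.mem_image.1 he
      exact (Finset.mem_filter.1 hp).2
    · induction e with
      | _ x y => exact relCost_nonneg x y
  · rintro ⟨w, k⟩ hp ⟨w', k'⟩ hp' h
    simp only [Finset.coe_filter, Finset.mem_product, Finset.mem_univ, and_true,
      Set.mem_ofPred_eq] at hp hp'
    obtain ⟨rfl, rfl⟩ := baseEdge_injective hp.1 hp'.1 h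
    rfl

/-! ### The side without label 4, and the conclusion. -/

theorem exists_ne_succ {β : Type*} {f : ℕ → β} {s r : ℕ} (h : s ≤ r) (hf : f s ≠ f r) :
    ∃ t, s ≤ t ∧ t < r ∧ f t ≠ f (t + 1) := by
  by_contra! H
  refine hf ?_
  induction r, h using Nat.le_induction with
  | base => rfl
  | succ r hr ih =>
    by_cases hsr : f s = f r
    · rw [hsr]; exact H r hr (Nat.lt_succ_self r)
    · exact absurd (ih hsr fun t h1 h2 => H t h1 (h2.trans (Nat.lt_succ_self r))) hsr

/-- A node labeled `3` on the side differs from both end terminals, so the labels change once on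
each side of it, giving two distinct cut edges. -/
theorem label_ne_last_of_card_le {m : ℕ} {σ : Equiv.Perm (Fin 3)} {Q : Node (m + 1) → Fin 4}
    (hQ : IsCut Q) (hcard : (cutSet Q ∩ sideEdges (m + 1) (σ 0) (σ 1)).card < 2) {a b : ℕ}
    (h : a + b = m + 1) : label σ Q a b 0 ≠ 3 := by
  intro h3
  have e0 : label σ Q 0 (m + 1 - 0) 0 = 1 := label_terminal (i := 1) hQ (by omega) rfl
  have e1 : label σ Q (m + 1) (m + 1 - (m + 1)) 0 = 0 := label_terminal (i := 0) hQ (by omega) rfl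
  obtain rfl : b = m + 1 - a := by omega
  obtain ⟨s, -, hs, hs'⟩ := exists_ne_succ (f := fun t => label σ Q t (m + 1 - t) 0)
    (s := 0) (r := a) (Nat.zero_le _) (by rw [e0, h3]; decide)
  obtain ⟨r, hr, hr0, hr'⟩ := exists_ne_succ (f := fun t => label σ Q t (m + 1 - t) 0)
    (s := a) (r := m + 1) (by omega) (by rw [e1, h3]; decide)
  have key : ∀ t < m + 1, label σ Q t (m + 1 - t) 0 ≠ label σ Q (t + 1) (m + 1 - (t + 1)) 0 →
      baseEdge (m + 1) σ (t, m - t, 0) 0 ∈ cutSet Q ∩ sideEdges (m + 1) (σ 0) (σ 1) := by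
    intro t ht hne
    rw [show m + 1 - t = m - t + 1 by omega, show m + 1 - (t + 1) = m - t by omega] at hne
    have hadj := (baseEdge_adj (m := m) (σ := σ) (a := t) (b := m - t) (c := 0) (by omega)).1
    have hsupp : ∀ x y, x + y + 0 = m + 1 →
        support (node (m + 1) σ x y 0) ⊆ {σ 0, σ 1} := by
      intro x y hxy l hl
      obtain ⟨l, rfl⟩ := σ.surjective l
      rw [support, Finset.mem_filter, node_val hxy] at hl
      fin_cases l <;> simp_all
    rw [Finset.mem_inter]
    refine ⟨mk_mem_cutSet.2 ⟨hadj, fun h => hne ?_⟩, ?_⟩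
    · dsimp only at h
      rw [label, label, h]
    · refine Finset.mem_filter.2 ⟨SimpleGraph.mem_edgeFinset.2 hadj, fun x hx => ?_⟩
      rcases Sym2.mem_iff.1 hx with rfl | rfl <;> exact hsupp _ _ (by dsimp only; omega)
  refine absurd hcard (not_lt.2 (Finset.one_lt_card.2
    ⟨_, key s (by omega) hs', _, key r hr0 hr', fun h => ?_⟩))
  have := (baseEdge_injective (mem_tri.2 (by dsimp only; omega)) (mem_tri.2 (by dsimp only; omega))
    h).1
  simp only [Prod.mk.injEq] at this
  omega

theorem card_label_eq {n : ℕ} (σ : Equiv.Perm (Fin 3)) (Q : Node n → Fin 4) :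
    ((tri n).filter fun u => label σ Q u.1 u.2.1 u.2.2 = 3).card =
      (Finset.univ.filter fun x => Q x = Fin.last 3).card := by
  have hsum : ∀ x : Node n, x.1 (σ 0) + x.1 (σ 1) + x.1 (σ 2) = n := fun x => by
    rw [← Fin.sum_univ_three fun i => x.1 (σ i), Equiv.sum_comp σ x.1, x.2]
  have hnode : ∀ x : Node n, node n σ (x.1 (σ 0)) (x.1 (σ 1)) (x.1 (σ 2)) = x := fun x => by
    ext l
    obtain ⟨l, rfl⟩ := σ.surjective l
    rw [node_val (hsum x)]
    fin_cases l <;> rfl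
  refine Finset.card_nbij' (fun u => node n σ u.1 u.2.1 u.2.2)
    (fun x => (x.1 (σ 0), x.1 (σ 1), x.1 (σ 2))) ?_ ?_ ?_ ?_
  · intro u hu
    exact Finset.mem_filter.2 ⟨Finset.mem_univ _, label_eq_last_iff.1 (Finset.mem_filter.1 hu).2⟩
  · intro x hx
    refine Finset.mem_filter.2 ⟨mem_tri.2 (hsum x), label_eq_last_iff.2 ?_⟩
    dsimp only
    rw [hnode]
    exact (Finset.mem_filter.1 hx).2
  · rintro ⟨a, b, c⟩ hu
    have := mem_tri.1 (Finset.mem_filter.1 hu).1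
    simp (disch := omega) [node_val]
  · intro x _
    exact hnode x

end AMM

theorem lemma8 (n : ℕ) (hn : 10 ≤ n) (Q : AMM.Node n → Fin 4) (hQ : AMM.IsNonOpposite Q)
    (hfrag : ¬ AMM.IsFragmenting Q) (α : ℝ)
    (hα : ((Finset.univ.filter fun x => Q x = Fin.last 3).card : ℝ) = α * (n : ℝ) ^ 2) :
    1.2 + 0.4 * α - 1 / (n : ℝ) ≤ AMM.costJ (AMM.cutSet Q) := by
  obtain ⟨m, rfl⟩ : ∃ m, n = m + 2 := ⟨n - 2, by omega⟩
  simp only [AMM.IsFragmenting, not_forall, not_le] at hfrag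
  obtain ⟨i, j, hij, hcard⟩ := hfrag
  obtain ⟨σ, rfl, rfl⟩ : ∃ σ : Equiv.Perm (Fin 3), σ 0 = i ∧ σ 1 = j :=
    (by decide : ∀ i j : Fin 3, i ≠ j → ∃ σ : Equiv.Perm (Fin 3), σ 0 = i ∧ σ 1 = j) i j hij
  have hlast := fun a b => AMM.label_ne_last_of_card_le hQ.1 hcard (a := a) (b := b)
  have hcore := AMM.le_sum_cutWeight (m := m) (by omega) (AMM.label σ Q)
    (fun a b c h h0 => Nat.pos_of_ne_zero (AMM.ne_zero_of_label_eq (i := 0) hQ h h0))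
    (fun a b c h h0 => Nat.pos_of_ne_zero (AMM.ne_zero_of_label_eq (i := 1) hQ h h0))
    (fun a b c h h0 => Nat.pos_of_ne_zero (AMM.ne_zero_of_label_eq (i := 2) hQ h h0))
    (fun a b c h h0 => Nat.pos_of_ne_zero (by rintro rfl; exact hlast a b h h0))
    (AMM.label_terminal (i := 2) hQ.1 (by omega) rfl)
  rw [AMM.card_label_eq, hα] at hcore
  have hcost : AMM.costJ (AMM.cutSet Q) =
      3 / (5 * ((m + 2 : ℕ) : ℝ)) * ∑ e ∈ AMM.cutSet Q, AMM.edgeRelCost e := by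
    rw [AMM.costJ, Finset.mul_sum]; rfl
  have hpos : (0 : ℝ) < ((m + 2 : ℕ) : ℝ) := by positivity
  rw [hcost]
  refine le_trans (le_of_eq ?_) (mul_le_mul_of_nonneg_left
    (hcore.trans (AMM.sum_cutWeight_le (by omega) σ Q)) (by positivity))
  -- With `n = m + 2` and `ρ = 3/(5n)`: `ρ(2n - 5/3) = 6/5 - 1/n` and `ρ · 2/(3n) · αn² = 2α/5`.
  field_simp
  ring
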